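/- Work in Cantor space $2^\omega$ with the fair-coin measure $\mu$; sets of natural numbers are identified with elements of $2^\omega$. The basic open sets are the cylinders $[\sigma]=\{X\in 2^\omega : X \succ \sigma\}$, $\sigma\in 2^{<\omega}$, and $\varnothing$; a code for an open set $U$ is a sequence $\langle C_s\rangle_{s\in\mathbb{N}}$ of basic open sets with $U=\bigcup_s C_s$. A function $f\in\mathbb{N}^{\mathbb{N}}$ encodes a Schnorr test $\langle U_n\rangle_{n\in\mathbb N}$ if it encodes, for each $n$, a code for the open set $U_n$ and a sequence of rationals $\langle q_s\rangle$ converging to $\mu(U_n)$ with $|q_m-q_k|\le 2^{-k}$ for all $m\ge k$, where $\mu(U_n)\le 2^{-n}$ for all $n$. A function is truth-table reducible to $B\in 2^\omega$ if it equals $\Phi(B)$ for some total computable functional $\Phi\colon 2^\omega\to\mathbb{N}^{\mathbb{N}}$. For $A,B\in 2^\omega$: (i) $A$ is Schnorr random relative to $B$ if there is no Schnorr test $\langle U_n\rangle$ encoded by a function computable from $B$ with $A\in\bigcap_n U_n$. (ii) $A$ is Schnorr random uniformly relative to $B$ if there is no total computable functional $\Phi\colon 2^\omega\to\mathbb{N}^{\mathbb{N}}$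 such that $\Phi(X)$ encodes a Schnorr test $\langle U^X_n\rangle$ for every $X\in 2^\omega$ and $A\in\bigcap_n U^B_n$. (iii) $A$ is truth-table (test) Schnorr random relative to $B$ if there is no sequence $\langle U_n\rangle$ of open sets, with codes uniformly truth-table reducible to $B$, such that $\mu(U_n)=2^{-n}$ and $A\in U_n$ for all $n$. Proposition. For all $A,B\in 2^\omega$, $A$ is truth-table (test) Schnorr random relative to $B$ if and only if $A$ is Schnorr random relative to $B$. Moreover, there exist $A,B\in 2^\omega$ such that $A$ is Schnorr random uniformly relative to $B$ but not truth-table (test) Schnorr random relative to $B$. -/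

import Mathlib

namespace SchnorrRel

open MeasureTheory Filter Topology
open scoped ENNReal

/-- Cantor space `2^ω`; a set of natural numbers is identified with its characteristic sequence. -/
abbrev Cantor : Type := ℕ → Bool

/-- The fair-coin measure on Cantor space. -/
noncomputable def fairCoin : Measure Cantor :=
  Measure.infinitePi fun _ : ℕ => (PMF.uniformOfFintype Bool).toMeasure

/-- The initial segment of `X` of length `k`. -/
def initSeg (X : Cantor) (k : ℕ) : List Bool := (List.range k).map X

/-- Basic open sets: `some σ` names the cylinder `[σ]` of all `X` extending `σ`,
and `none` names the empty set. -/
def basicOpen : Option (List Bool) → Set Cantor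
  | none => ∅
  | some σ => {X | initSeg X σ.length = σ}

/-- The open set coded by a sequence of (names of) basic open sets. -/
def openOfCode (C : ℕ → Option (List Bool)) : Set Cantor := ⋃ s, basicOpen (C s)

/-- Triples of natural numbers name rationals; every rational has a name. -/
def ratOfCode (p : ℕ × ℕ × ℕ) : ℚ := ((p.1 : ℚ) - p.2.1) / (p.2.2 + 1)

/-- A sequence of rationals is fast-Cauchy if `|q m - q k| ≤ 2 ^ (-k)` whenever `k ≤ m`. -/
def FastCauchy (q : ℕ → ℚ) : Prop := ∀ k m : ℕ, k ≤ m → |q m - q k| ≤ (1 / 2) ^ k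

/-- The oracle given by the characteristic function of `B`. -/
def oracle (B : Cantor) : Set (ℕ →. ℕ) := {fun n => Part.some (B n).toNat}

/-- `Φ`, sending each oracle `X` to a total function `Φ X : α → σ`, is a total computable
functional: some computable `φ` returns, on a long enough initial segment of `X`, the value
`Φ X a`, and on every initial segment of `X` returns either this value or no answer (`none`). -/
def TotalComputableFunctional {α σ : Type} [Primcodable α] [Primcodable σ]
    (Φ : Cantor → α → σ) : Prop :=
  ∃ φ : List Bool → α → Option σ, Computable₂ φ ∧
    ∀ (X : Cantor) (a : α),
      (∃ k, φ (initSeg X k) a = some (Φ X a)) ∧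
      ∀ k v, φ (initSeg X k) a = some v → v = Φ X a

/-- `f` is truth-table reducible to `B`: it is the value at `B` of a total computable functional. -/
def TTReducible {α σ : Type} [Primcodable α] [Primcodable σ] (f : α → σ) (B : Cantor) : Prop :=
  ∃ Φ : Cantor → α → σ, TotalComputableFunctional Φ ∧ Φ B = f

/-- A function that may code a Schnorr test: the value at `(n, s)` consists of (the name of) the
`s`-th basic open set in the listing of `U n`, and (the name of) the `s`-th rational
approximation of the measure of `U n`. -/
abbrev TestCode : Type := ℕ × ℕ → Option (List Bool) × (ℕ × ℕ × ℕ)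

/-- The `n`-th open set `U n` listed by `c`. -/
def TestCode.level (c : TestCode) (n : ℕ) : Set Cantor := openOfCode fun s => (c (n, s)).1

/-- The sequence of rationals that `c` provides for the measure of `U n`. -/
def TestCode.approx (c : TestCode) (n s : ℕ) : ℚ := ratOfCode (c (n, s)).2

/-- `c` encodes a Schnorr test: `μ (U n) ≤ 2 ^ (-n)`, and the rationals provided for `U n` form
a fast-Cauchy sequence converging to `μ (U n)`. -/
def IsSchnorrTest (c : TestCode) : Prop :=
  ∀ n, fairCoin (c.level n) ≤ (2⁻¹ : ℝ≥0∞) ^ n ∧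
    FastCauchy (c.approx n) ∧
    Tendsto (fun s => (c.approx n s : ℝ)) atTop (𝓝 (fairCoin (c.level n)).toReal)

/-- `A` is Schnorr random relative to `B`: no Schnorr test computable from `B` covers `A`. -/
def SchnorrRandomRelativeTo (A B : Cantor) : Prop :=
  ¬ ∃ c : TestCode, ComputableIn (oracle B) c ∧ IsSchnorrTest c ∧ ∀ n, A ∈ c.level n

/-- A uniform Schnorr test: a total computable map all of whose values encode Schnorr tests. -/
def IsUniformSchnorrTest (Φ : Cantor → TestCode) : Prop :=
  TotalComputableFunctional Φ ∧ ∀ X, IsSchnorrTest (Φ X)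

/-- `A` is Schnorr random uniformly relative to `B`. -/
def SchnorrRandomUniformlyRelativeTo (A B : Cantor) : Prop :=
  ¬ ∃ Φ : Cantor → TestCode, IsUniformSchnorrTest Φ ∧ ∀ n, A ∈ (Φ B).level n

/-- `A` is "truth-table (test) Schnorr random" relative to `B`: there is no sequence `U n` of open
sets, with codes uniformly truth-table reducible to `B`, such that `μ (U n) = 2 ^ (-n)` and
`A ∈ U n` for all `n`. -/
def TTTestSchnorrRandomRelativeTo (A B : Cantor) : Prop :=
  ¬ ∃ C : ℕ × ℕ → Option (List Bool), TTReducible C B ∧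
    (∀ n, fairCoin (openOfCode fun s => C (n, s)) = (2⁻¹ : ℝ≥0∞) ^ n) ∧
    ∀ n, A ∈ openOfCode fun s => C (n, s)

end SchnorrRel

/-!
Let `U n` be the levels of a Schnorr test computable from `B`. As the measure of `U n` is computable
from `B`, one can list all initial intervals of the lexicographic order whose union with `U n` has
measure below `2 ^ (-n)`; adding them fills `U n` up to measure exactly `2 ^ (-n)`. The resulting
code is computable from `B`, and it becomes truth-table reducible to `B` if it lists the empty set
while waiting for the computation: only the codes, no longer the measures, have to be provided by
a total functional. Conversely, levels of measure `2 ^ (-n)` come with constant approximations of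
their measure.

For the separation, `A` is made computable from `B`, hence not Schnorr random relative to `B`, by
letting `B` announce the bits of `A`, each at a place that can be chosen arbitrarily large. The
levels of a uniform test are defined for every oracle and, up to sets of small measure, vary upper
semicontinuously with it. So a finite extension argument can handle the countably many uniform tests
one by one, keeping a set of positive measure of possible `A`, if each announcement is placed so
late that it hardly enlarges the levels avoided so far.
-/

namespace SchnorrRel

open MeasureTheory Filter Topology
open scoped ENNReal

/-! ### Cylinders -/

section Cylinders

variable {X Y : Cantor} {k n : ℕ}

instance : IsProbabilityMeasure fairCoin := by
  unfold fairCoin; infer_instance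

@[simp]
theorem length_initSeg (X : Cantor) (k : ℕ) : (initSeg X k).length = k := by
  simp [initSeg]

theorem initSeg_succ (X : Cantor) (k : ℕ) : initSeg X (k + 1) = initSeg X k ++ [X k] := by
  simp [initSeg, List.range_succ]

theorem take_initSeg (X : Cantor) (h : n ≤ k) : (initSeg X k).take n = initSeg X n := by
  simp [initSeg, ← List.map_take, List.take_range, min_eq_left h]

theorem getElem?_initSeg (X : Cantor) (h : n < k) : (initSeg X k)[n]? = some (X n) := by
  simp [initSeg, h]

theorem initSeg_eq_initSeg_iff : initSeg Y k = initSeg X k ↔ Y ∈ PiNat.cylinder X k := by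
  simp [initSeg, PiNat.mem_cylinder_iff]

theorem exists_initSeg_eq (σ : List Bool) : ∃ X : Cantor, initSeg X σ.length = σ :=
  ⟨fun i => σ.getD i false, List.ext_getElem (by simp) fun i _ h => by simp [initSeg, h]⟩

theorem basicOpen_initSeg (X : Cantor) (k : ℕ) :
    basicOpen (some (initSeg X k)) = PiNat.cylinder X k := by
  ext Y
  simp [basicOpen, initSeg_eq_initSeg_iff]

theorem mem_basicOpen_initSeg (X : Cantor) (k : ℕ) : X ∈ basicOpen (some (initSeg X k)) := by
  simp [basicOpen]

theorem basicOpen_eq_union (σ : List Bool) :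
    basicOpen (some σ) = basicOpen (some (σ ++ [false])) ∪ basicOpen (some (σ ++ [true])) := by
  ext X
  cases hX : X σ.length <;> simp [basicOpen, initSeg_succ, hX]

theorem isOpen_basicOpen (o : Option (List Bool)) : IsOpen (basicOpen o) := by
  cases o with
  | none => exact isOpen_empty
  | some σ =>
    obtain ⟨X, hX⟩ := exists_initSeg_eq σ
    rw [← hX, basicOpen_initSeg]
    exact PiNat.isOpen_cylinder _ X _

theorem isOpen_openOfCode (C : ℕ → Option (List Bool)) : IsOpen (openOfCode C) :=
  isOpen_iUnion fun s => isOpen_basicOpen (C s)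

theorem hasAntitoneBasis_cylinder (X : Cantor) :
    (𝓝 X).HasAntitoneBasis fun k => PiNat.cylinder X k where
  antitone _ _ := PiNat.cylinder_anti X
  mem_iff' s := by
    rw [(PiNat.isTopologicalBasis_cylinders fun _ => Bool).mem_nhds_iff]
    constructor
    · rintro ⟨_, ⟨Y, k, rfl⟩, hX, hs⟩
      exact ⟨k, trivial, (PiNat.mem_cylinder_iff_eq.1 hX).trans_subset hs⟩
    · rintro ⟨k, -, hs⟩
      exact ⟨_, ⟨X, k, rfl⟩, PiNat.self_mem_cylinder X k, hs⟩

theorem fairCoin_cylinder (X : Cantor) (k : ℕ) :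
    fairCoin (PiNat.cylinder X k) = (2⁻¹ : ℝ≥0∞) ^ k := by
  have h : PiNat.cylinder X k = Set.pi (Finset.range k : Set ℕ) fun i => {X i} := by
    ext Y; simp [Set.mem_pi, PiNat.mem_cylinder_iff]
  rw [h, fairCoin, Measure.infinitePi_pi _ fun i _ => measurableSet_singleton _]
  simp

theorem fairCoin_real_basicOpen (σ : List Bool) :
    fairCoin.real (basicOpen (some σ)) = (1 / 2) ^ σ.length := by
  obtain ⟨X, hX⟩ := exists_initSeg_eq σ
  rw [← hX, basicOpen_initSeg, length_initSeg, Measure.real, fairCoin_cylinder]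
  simp

theorem fairCoin_eq_iff_real {s : Set Cantor} :
    fairCoin s = (2⁻¹ : ℝ≥0∞) ^ n ↔ fairCoin.real s = (1 / 2) ^ n := by
  rw [Measure.real, ← ENNReal.toReal_eq_toReal_iff' (measure_ne_top _ _) (by simp)]
  simp

theorem fairCoin_le_iff_real {s : Set Cantor} :
    fairCoin s ≤ (2⁻¹ : ℝ≥0∞) ^ n ↔ fairCoin.real s ≤ (1 / 2) ^ n := by
  rw [Measure.real, ← ENNReal.toReal_le_toReal (measure_ne_top _ _) (by simp)]
  simp

end Cylinders

/-! ### Computations with an oracle -/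

section RelativeComputability

open Encodable

variable {α β γ σ : Type} [Primcodable α] [Primcodable β] [Primcodable γ] [Primcodable σ]
  {O : Set (ℕ →. ℕ)}

theorem computableIn_iff_exists_nat {f : α → σ} :
    ComputableIn O f ↔
      ∃ h : ℕ → Part ℕ, Nat.RecursiveIn O h ∧ ∀ a, h (encode a) = Part.some (encode (f a)) := by
  refine ⟨fun hf => ⟨_, hf, fun a => by simp⟩, fun ⟨h, hh, hf⟩ => ?_⟩
  have hdecode : Nat.Partrec fun n => Part.bind (decode (α := α) n : Part α) fun a =>
      (Part.some a).map encode := Partrec.some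
  refine (hh.comp hdecode.recursiveIn).of_eq fun n => ?_
  cases decode (α := α) n <;> simp [hf]

theorem computableIn_comp {g : β → γ} {f : α → β} (hg : ComputableIn O g)
    (hf : ComputableIn O f) : ComputableIn O fun a => g (f a) := by
  obtain ⟨g', hg', hgg'⟩ := computableIn_iff_exists_nat.1 hg
  obtain ⟨f', hf', hff'⟩ := computableIn_iff_exists_nat.1 hf
  exact computableIn_iff_exists_nat.2 ⟨_, hg'.comp hf', fun a => by simp [hgg', hff']⟩

theorem computableIn_prodMk {f : α → β} {g : α → γ} (hf : ComputableIn O f)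
    (hg : ComputableIn O g) : ComputableIn O fun a => (f a, g a) := by
  obtain ⟨f', hf', hff'⟩ := computableIn_iff_exists_nat.1 hf
  obtain ⟨g', hg', hgg'⟩ := computableIn_iff_exists_nat.1 hg
  exact computableIn_iff_exists_nat.2
    ⟨_, hf'.pair hg', fun a => by simp [hff', hgg', Seq.seq]⟩

theorem computableIn_nat_rec {f : α → σ} {g : α × ℕ × σ → σ} (hf : ComputableIn O f)
    (hg : ComputableIn O g) :
    ComputableIn O fun p : α × ℕ =>
      (p.2.rec (f p.1) fun y ih => g (p.1, y, ih) : σ) := by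
  obtain ⟨f', hf', hff'⟩ := computableIn_iff_exists_nat.1 hf
  obtain ⟨g', hg', hgg'⟩ := computableIn_iff_exists_nat.1 hg
  refine computableIn_iff_exists_nat.2 ⟨_, hf'.prec hg', fun ⟨a, n⟩ => ?_⟩
  simp only [encode_prod_val, encode_nat, Nat.unpair_pair]
  induction n with
  | zero => exact hff' a
  | succ n ih =>
    simp only [Part.bind_eq_bind] at ih ⊢
    rw [ih, Part.bind_some]
    exact hgg' (a, n, _)

theorem computableIn_range_map {c : α × ℕ → σ} (hc : ComputableIn O c) :
    ComputableIn O fun p : α × ℕ => (List.range p.2).map fun i => c (p.1, i) := by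
  have happend : ComputableIn O fun q : α × ℕ × List σ => q.2.2 ++ [c (q.1, q.2.1)] :=
    computableIn_comp (f := fun q : α × ℕ × List σ => (q.2.2, c (q.1, q.2.1)))
      (Computable.list_concat (α := σ)).computableIn
      (computableIn_prodMk (Computable.snd.comp Computable.snd).computableIn
        (computableIn_comp hc
          (Computable.fst.pair (Computable.fst.comp Computable.snd)).computableIn))
  convert computableIn_nat_rec (ComputableIn.const ([] : List σ)) happend with p
  induction p.2 with
  | zero => rfl
  | succ n ih => simp [List.range_succ, ih]

theorem computableIn_of_search {p : α × ℕ → Option σ} {f : α → σ} (hp : ComputableIn O p)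
    (hsome : ∀ a, ∃ k, p (a, k) = some (f a)) (heq : ∀ a k v, p (a, k) = some v → v = f a) :
    ComputableIn O f := by
  have hnone : Computable fun o : Option σ => bif o.isSome then 0 else 1 :=
    (Primrec.cond Primrec.option_isSome (Primrec.const 0) (Primrec.const 1)).to_comp
  obtain ⟨q, hq, hqp⟩ := computableIn_iff_exists_nat.1 (computableIn_comp hnone.computableIn hp)
  have hk : ∀ a, ∃ k, k ∈ Nat.rfind (fun k => (fun m => decide (m = 0)) <$>
      q (Nat.pair (encode a) k)) ∧ p (a, k) = some (f a) := by
    intro a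
    have hval : ∀ k, q (Nat.pair (encode a) k) =
        Part.some (bif (p (a, k)).isSome then 0 else 1) := fun k => hqp (a, k)
    obtain ⟨k₀, hk₀⟩ := hsome a
    obtain ⟨k, hk⟩ := Part.dom_iff_mem.1 ((Nat.rfind_dom
      (p := fun k => (fun m => decide (m = 0)) <$> q (Nat.pair (encode a) k))).2
      ⟨k₀, by simp [hval, hk₀], fun _ => by simp [hval]⟩)
    refine ⟨k, hk, ?_⟩
    have hfound := Nat.rfind_spec hk
    cases hpk : p (a, k) with
    | none => simp [hval, hpk] at hfound
    | some v => rw [heq a k v hpk]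
  choose k hk hpk using hk
  have hkO : ComputableIn O k := computableIn_iff_exists_nat.2
    ⟨_, hq.rfind, fun a => Part.eq_some_iff.2 (hk a)⟩
  obtain ⟨p', hp', hpp'⟩ := computableIn_iff_exists_nat.1
    (computableIn_comp hp (computableIn_prodMk ComputableIn.id hkO))
  have hpred : Nat.RecursiveIn O (Part.some ∘ Nat.pred) :=
    Nat.Partrec.recursiveIn (Partrec.nat_iff.1 Computable.pred.partrec)
  exact computableIn_iff_exists_nat.2
    ⟨_, hpred.comp hp', fun a => by simp [Part.bind_eq_bind, hpp', hpk, encode_some]⟩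

end RelativeComputability

section UsePrinciple

open Encodable

variable {α σ : Type} [Primcodable α] [Primcodable σ] {B : Cantor}

theorem computableIn_oracle (B : Cantor) : ComputableIn (oracle B) B := by
  have hB : ComputableIn (oracle B) fun n => (B n).toNat :=
    RecursiveIn.iff_nat.2 (Nat.RecursiveIn.oracle _ rfl)
  have hone : Primrec fun m : ℕ => decide (m = 1) :=
    (Primrec.eq.comp Primrec.id (Primrec.const 1)).decide
  convert computableIn_comp hone.to_comp.computableIn hB with n
  cases B n <;> rfl

theorem computableIn_initSeg (B : Cantor) : ComputableIn (oracle B) (initSeg B) :=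
  computableIn_comp (f := fun k => ((), k))
    (computableIn_range_map (computableIn_comp (computableIn_oracle B) ComputableIn.snd))
    (computableIn_prodMk (ComputableIn.const ()) ComputableIn.id)

theorem TTReducible.computableIn {f : α → σ} (h : TTReducible f B) :
    ComputableIn (oracle B) f := by
  obtain ⟨Φ, ⟨φ, hφ, hΦ⟩, rfl⟩ := h
  exact computableIn_of_search (computableIn_comp hφ.computableIn
      (computableIn_prodMk (computableIn_comp (computableIn_initSeg B) ComputableIn.snd)
        ComputableIn.fst))
    (fun a => (hΦ B a).1) fun a => (hΦ B a).2

theorem totalComputableFunctional_of_use {F : List Bool → α → σ} {u : α → ℕ}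
    (hF : Computable₂ F) (hu : Computable u) :
    TotalComputableFunctional fun X a => F (initSeg X (u a)) a := by
  refine ⟨fun τ a => bif τ.length == u a then some (F τ a) else none, ?_,
    fun X a => ⟨⟨u a, ?_⟩, ?_⟩⟩
  · exact Computable.cond (Primrec.beq.to_comp.comp
      (Computable.list_length.comp Computable.fst) (hu.comp Computable.snd))
      (Computable.option_some.comp hF) (Computable.const none)
  · simp
  · intro k v hv
    by_cases hk : k = u a
    · subst hk; simpa [eq_comm] using hv
    · simp [beq_false_of_ne hk] at hv

/-- `G` computes the partial function `f` from the initial segments of `B`: its answers are values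
of `f`, and every value of `f` is given on all sufficiently long initial segments. This is the form
of the use principle in which the partial recursive functions in `B` can be built up. -/
structure SegApprox (B : Cantor) (f : ℕ → Part ℕ) (G : List Bool → ℕ → Part ℕ) : Prop where
  partrec : Partrec₂ G
  sound : ∀ {k n v}, v ∈ G (initSeg B k) n → v ∈ f n
  eventually_mem : ∀ {n v}, v ∈ f n → ∀ᶠ k in atTop, v ∈ G (initSeg B k) n

namespace SegApprox

variable {f g : ℕ → Part ℕ} {F G : List Bool → ℕ → Part ℕ}

theorem of_partrec (hf : Nat.Partrec f) : SegApprox B f fun _ n => f n where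
  partrec := (Partrec.nat_iff.2 hf).comp Computable.snd
  sound hv := hv
  eventually_mem hv := .of_forall fun _ => hv

theorem oracle : SegApprox B (fun n => Part.some (B n).toNat)
    fun τ n => ((τ[n]?).map Bool.toNat : Option ℕ) where
  partrec := Computable.ofOption <|
    Computable.option_map (Computable.list_getElem?.comp Computable.fst Computable.snd)
      ((Primrec.dom_finite Bool.toNat).to_comp.comp Computable.snd)
  sound {k n v} hv := by
    simp only [Part.mem_ofOption, Option.mem_def, Option.map_eq_some_iff] at hv
    obtain ⟨b, hb, rfl⟩ := hv
    have hn : n < k := by simpa using (List.getElem?_eq_some_iff.1 hb).1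
    rw [getElem?_initSeg B hn, Option.some_inj] at hb
    simp [hb]
  eventually_mem {n v} hv := by
    filter_upwards [eventually_gt_atTop n] with k hk
    simpa [getElem?_initSeg B hk, eq_comm] using hv

theorem comp (hf : SegApprox B f F) (hg : SegApprox B g G) :
    SegApprox B (fun n => g n >>= f) fun τ n => G τ n >>= F τ where
  partrec := Partrec.bind (f := fun p : List Bool × ℕ => G p.1 p.2) hg.partrec
    (Partrec.comp (f := fun p : List Bool × ℕ => F p.1 p.2) hf.partrec
      (Computable.pair (Computable.fst.comp Computable.fst) Computable.snd))
  sound hv := by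
    obtain ⟨a, ha, hv⟩ := Part.mem_bind_iff.1 hv
    exact Part.mem_bind_iff.2 ⟨a, hg.sound ha, hf.sound hv⟩
  eventually_mem hv := by
    obtain ⟨a, ha, hv⟩ := Part.mem_bind_iff.1 hv
    filter_upwards [hg.eventually_mem ha, hf.eventually_mem hv] with k ha hv
    exact Part.mem_bind_iff.2 ⟨a, ha, hv⟩

theorem mem_pair_iff {x y : Part ℕ} {v : ℕ} :
    v ∈ Nat.pair <$> x <*> y ↔ ∃ a ∈ x, ∃ b ∈ y, Nat.pair a b = v := by
  simp [Seq.seq]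

theorem pair (hf : SegApprox B f F) (hg : SegApprox B g G) :
    SegApprox B (fun n => Nat.pair <$> f n <*> g n) fun τ n => Nat.pair <$> F τ n <*> G τ n where
  partrec := by
    have hmap : Partrec₂ fun (p : List Bool × ℕ) (a : ℕ) => (G p.1 p.2).map (Nat.pair a) :=
      Partrec.map (f := fun q : (List Bool × ℕ) × ℕ => G q.1.1 q.1.2)
        (g := fun q b => Nat.pair q.2 b)
        (Partrec.comp (f := fun p : List Bool × ℕ => G p.1 p.2) hg.partrec Computable.fst)
        (Primrec₂.natPair.to_comp.comp (Computable.snd.comp Computable.fst) Computable.snd)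
    refine (Partrec.bind (f := fun p : List Bool × ℕ => F p.1 p.2)
      hf.partrec hmap).of_eq fun p => ?_
    simp [Seq.seq, Part.bind_map]
  sound hv := by
    obtain ⟨a, ha, b, hb, hv⟩ := mem_pair_iff.1 hv
    exact mem_pair_iff.2 ⟨a, hf.sound ha, b, hg.sound hb, hv⟩
  eventually_mem hv := by
    obtain ⟨a, ha, b, hb, hv⟩ := mem_pair_iff.1 hv
    filter_upwards [hf.eventually_mem ha, hg.eventually_mem hb] with k ha hb
    exact mem_pair_iff.2 ⟨a, ha, b, hb, hv⟩

theorem prec (hf : SegApprox B f F) (hg : SegApprox B g G) :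
    SegApprox B
      (fun p => p.unpair.2.rec (f p.unpair.1) fun y ih =>
        ih.bind fun i => g (Nat.pair p.unpair.1 (Nat.pair y i)))
      fun τ p => p.unpair.2.rec (F τ p.unpair.1) fun y ih =>
        ih.bind fun i => G τ (Nat.pair p.unpair.1 (Nat.pair y i)) where
  partrec := by
    have hfst : Computable fun p : List Bool × ℕ => p.2.unpair.1 :=
      Computable.fst.comp (Computable.unpair.comp Computable.snd)
    have hsnd : Computable fun p : List Bool × ℕ => p.2.unpair.2 :=
      Computable.snd.comp (Computable.unpair.comp Computable.snd)
    refine Partrec.nat_rec (f := fun p : List Bool × ℕ => p.2.unpair.2)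
      (g := fun p => F p.1 p.2.unpair.1)
      (h := fun p q => G p.1 (Nat.pair p.2.unpair.1 (Nat.pair q.1 q.2))) hsnd
      (hf.partrec.comp (f := fun τ n => F τ n) Computable.fst hfst)
      (Partrec₂.comp (f := fun τ n => G τ n) hg.partrec (Computable.fst.comp Computable.fst)
        (Primrec₂.natPair.to_comp.comp (hfst.comp Computable.fst)
          (Primrec₂.natPair.to_comp.comp (Computable.fst.comp Computable.snd)
            (Computable.snd.comp Computable.snd))))
  sound {k p v} hv := by
    generalize p.unpair.2 = m at hv
    induction m generalizing v with
    | zero => exact hf.sound hv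
    | succ m ih =>
      obtain ⟨i, hi, hv⟩ := Part.mem_bind_iff.1 hv
      exact Part.mem_bind_iff.2 ⟨i, ih hi, hg.sound hv⟩
  eventually_mem {p v} hv := by
    generalize p.unpair.2 = m at hv
    induction m generalizing v with
    | zero => exact hf.eventually_mem hv
    | succ m ih =>
      obtain ⟨i, hi, hv⟩ := Part.mem_bind_iff.1 hv
      filter_upwards [ih hi, hg.eventually_mem hv] with k hi hv
      exact Part.mem_bind_iff.2 ⟨i, hi, hv⟩

theorem mem_rfind_iff {x : ℕ → Part ℕ} {v : ℕ} :
    v ∈ Nat.rfind (fun n => (fun m => decide (m = 0)) <$> x n) ↔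
      0 ∈ x v ∧ ∀ m < v, ∃ b ∈ x m, b ≠ 0 :=
  Nat.mem_rfind.trans (and_congr (by simp) (forall₂_congr fun m _ => by simp))

theorem rfind (hf : SegApprox B f F) :
    SegApprox B (fun a => Nat.rfind fun n => (fun m => decide (m = 0)) <$> f (Nat.pair a n))
      fun τ a => Nat.rfind fun n => (fun m => decide (m = 0)) <$> F τ (Nat.pair a n) where
  partrec := Partrec.rfind (p := fun p : List Bool × ℕ => fun n =>
      (fun m => decide (m = 0)) <$> F p.1 (Nat.pair p.2 n)) <|
    Partrec.map (f := fun q : (List Bool × ℕ) × ℕ => F q.1.1 (Nat.pair q.1.2 q.2))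
      (Partrec₂.comp (f := fun τ n => F τ n) hf.partrec (Computable.fst.comp Computable.fst)
        (Primrec₂.natPair.to_comp.comp (Computable.snd.comp Computable.fst) Computable.snd))
      (Primrec.eq.comp Primrec.snd (Primrec.const 0)).decide.to_comp
  sound hv := by
    obtain ⟨hzero, hlt⟩ := mem_rfind_iff.1 hv
    exact mem_rfind_iff.2 ⟨hf.sound hzero, fun m hm =>
      let ⟨b, hb, hne⟩ := hlt m hm; ⟨b, hf.sound hb, hne⟩⟩
  eventually_mem {n v} hv := by
    obtain ⟨hzero, hlt⟩ := mem_rfind_iff.1 hv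
    have hlt' : ∀ᶠ k in atTop, ∀ m ∈ Set.Iio v, ∃ b ∈ F (initSeg B k) (Nat.pair n m), b ≠ 0 :=
      (Filter.eventually_all_finite (Set.finite_Iio v)).2 fun m hm =>
        let ⟨b, hb, hne⟩ := hlt m hm
        (hf.eventually_mem hb).mono fun k hk => ⟨b, hk, hne⟩
    filter_upwards [hf.eventually_mem hzero, hlt'] with k hzero hlt
    exact mem_rfind_iff.2 ⟨hzero, hlt⟩

end SegApprox

theorem exists_segApprox {f : ℕ →. ℕ} (hf : Nat.RecursiveIn (oracle B) f) :
    ∃ G, SegApprox B f G := by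
  induction hf with
  | zero => exact ⟨_, .of_partrec .zero⟩
  | succ => exact ⟨_, .of_partrec .succ⟩
  | left => exact ⟨_, .of_partrec .left⟩
  | right => exact ⟨_, .of_partrec .right⟩
  | oracle g hg =>
    obtain rfl : g = _ := hg
    exact ⟨_, .oracle⟩
  | pair _ _ ih₁ ih₂ => exact ih₁.elim fun _ h₁ => ih₂.elim fun _ h₂ => ⟨_, h₁.pair h₂⟩
  | comp _ _ ih₁ ih₂ => exact ih₁.elim fun _ h₁ => ih₂.elim fun _ h₂ => ⟨_, h₁.comp h₂⟩
  | prec _ _ ih₁ ih₂ => exact ih₁.elim fun _ h₁ => ih₂.elim fun _ h₂ => ⟨_, h₁.prec h₂⟩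
  | rfind _ ih => exact ih.elim fun _ h => ⟨_, h.rfind⟩

theorem exists_computable_use {f : α → σ} (hf : ComputableIn (oracle B) f) :
    ∃ φ : List Bool → α → Option σ, Computable₂ φ ∧
      ∀ a, (∃ k, φ (initSeg B k) a = some (f a)) ∧
        ∀ k v, φ (initSeg B k) a = some v → v = f a := by
  obtain ⟨h, hh, hhf⟩ := computableIn_iff_exists_nat.1 hf
  obtain ⟨G, hG⟩ := exists_segApprox hh
  obtain ⟨e, he⟩ := Nat.Partrec.Code.exists_code.1 (show Nat.Partrec _ from hG.partrec)
  have heval : ∀ τ n, e.eval (encode (τ, n)) = G τ n := fun τ n => by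
    rw [he]; simp [Part.map_id']
  -- a segment of length `Nat.pair k t` answers for the segment of length `k` after `t` steps
  refine ⟨fun τ a => (e.evaln τ.length
    (encode (τ.take τ.length.unpair.1, encode a))).bind decode, ?_, fun a => ⟨?_, fun k v hv => ?_⟩⟩
  · refine Computable.option_bind (Primrec.to_comp ?_) (Computable.decode.comp Computable.snd)
    have hlen : Primrec fun p : List Bool × α => p.1.length :=
      Primrec.list_length.comp Primrec.fst
    exact Nat.Partrec.Code.primrec_evaln.comp (Primrec.pair (Primrec.pair hlen (Primrec.const e))
      (Primrec.encode.comp (Primrec.pair (Primrec.list_take.comp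
        (Primrec.fst.comp (Primrec.unpair.comp hlen)) Primrec.fst)
          (Primrec.encode.comp Primrec.snd))))
  · have hfa : encode (f a) ∈ h (encode a) := hhf a ▸ Part.mem_some _
    obtain ⟨k, hk⟩ := (hG.eventually_mem hfa).exists
    obtain ⟨t, ht⟩ := Nat.Partrec.Code.evaln_complete.1 (heval _ _ ▸ hk)
    have ht' := Nat.Partrec.Code.evaln_mono (Nat.right_le_pair k t) ht
    refine ⟨Nat.pair k t, ?_⟩
    simp only [length_initSeg, Nat.unpair_pair, take_initSeg B (Nat.left_le_pair k t)]
    rw [Option.mem_def.1 ht', Option.bind_some, encodek]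
  · simp only [length_initSeg, take_initSeg B (Nat.unpair_left_le k)] at hv
    obtain ⟨x, hx, hxv⟩ := Option.bind_eq_some_iff.1 hv
    have hxG := hG.sound (heval _ _ ▸ Nat.Partrec.Code.evaln_sound hx)
    rw [hhf, Part.mem_some_iff] at hxG
    simpa [hxG, eq_comm] using hxv

theorem exists_ttReducible_openOfCode_eq {ι : Type} [Primcodable ι]
    {C : ℕ × ι → Option (List Bool)} (hC : ComputableIn (oracle B) C) :
    ∃ C' : ℕ × ℕ → Option (List Bool), TTReducible C' B ∧
      ∀ n, openOfCode (fun s => C' (n, s)) = ⋃ i, basicOpen (C (n, i)) := by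
  obtain ⟨φ, hφ, hCφ⟩ := exists_computable_use hC
  have hw : Computable fun p : ℕ × ℕ => p.2.unpair := Computable.unpair.comp Computable.snd
  -- the empty set is listed as long as the computation of `C` gives no answer
  let F : List Bool → ℕ × ℕ → Option (List Bool) := fun τ p =>
    ((decode (α := ι) p.2.unpair.2).bind fun i => φ τ (p.1, i)).getD none
  have hF : Computable₂ F := by
    refine Computable.option_getD (Computable.option_bind (Computable.decode.comp
      (Computable.snd.comp (hw.comp Computable.snd))) ?_) (Computable.const none)
    exact hφ.comp (Computable.fst.comp Computable.fst)
      ((Computable.fst.comp (Computable.snd.comp Computable.fst)).pair Computable.snd)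
  refine ⟨fun p => F (initSeg B p.2.unpair.1) p,
    ⟨_, totalComputableFunctional_of_use hF (Computable.fst.comp hw), rfl⟩, fun n => ?_⟩
  refine (Set.iUnion_subset fun w => ?_).antisymm (Set.iUnion_subset fun i => ?_)
  · cases h : (decode (α := ι) w.unpair.2).bind fun i => φ (initSeg B w.unpair.1) (n, i) with
    | none => simp [F, h, basicOpen]
    | some o =>
      obtain ⟨i, -, hi⟩ := Option.bind_eq_some_iff.1 h
      simp only [F, h, Option.getD_some, (hCφ (n, i)).2 _ o hi]
      exact Set.subset_iUnion (fun i => basicOpen (C (n, i))) i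
  · obtain ⟨k, hk⟩ := (hCφ (n, i)).1
    refine Set.subset_iUnion_of_subset (Nat.pair k (encode i)) ?_
    simp [F, hk]

end UsePrinciple

/-! ### Initial intervals of the lexicographic order -/

section Intervals

variable {S T : List (List Bool)} {σ τ : List Bool} {X : Cantor} {M i j : ℕ}

/-- The clopen set given by a finite list of strings. -/
def clopen (S : List (List Bool)) : Set Cantor := ⋃ σ ∈ S, basicOpen (some σ)

theorem mem_clopen : X ∈ clopen S ↔ ∃ σ ∈ S, X ∈ basicOpen (some σ) := by
  simp [clopen]

theorem clopen_cons (σ : List Bool) (S : List (List Bool)) :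
    clopen (σ :: S) = basicOpen (some σ) ∪ clopen S := by
  ext X; simp [mem_clopen]

theorem clopen_mono (h : S ⊆ T) : clopen S ⊆ clopen T :=
  Set.biUnion_subset_biUnion_left h

theorem clopen_flatMap_split (S : List (List Bool)) :
    clopen (S.flatMap fun σ => [σ ++ [false], σ ++ [true]]) = clopen S := by
  induction S with
  | nil => simp
  | cons σ S ih =>
    simp only [List.flatMap_cons, List.cons_append, List.nil_append, clopen_cons, ih]
    rw [← Set.union_assoc, ← basicOpen_eq_union]

theorem isOpen_clopen (S : List (List Bool)) : IsOpen (clopen S) :=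
  isOpen_biUnion fun σ _ => isOpen_basicOpen (some σ)

theorem fairCoin_real_clopen (hS : S.Nodup) (hM : ∀ σ ∈ S, σ.length = M) :
    fairCoin.real (clopen S) = S.length * (1 / 2) ^ M := by
  induction S with
  | nil => simp [clopen]
  | cons σ S ih =>
    obtain ⟨hσ, hS⟩ := List.nodup_cons.1 hS
    obtain ⟨hσM, hM⟩ := List.forall_mem_cons.1 hM
    have hdisj : Disjoint (basicOpen (some σ)) (clopen S) := by
      refine Set.disjoint_left.2 fun X hX hXS => ?_
      obtain ⟨τ, hτ, hXτ⟩ := mem_clopen.1 hXS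
      simp only [basicOpen, Set.mem_ofPred_eq, hσM, hM τ hτ] at hX hXτ
      exact hσ (hX ▸ hXτ ▸ hτ)
    rw [clopen_cons, measureReal_union hdisj (isOpen_clopen S).measurableSet,
      fairCoin_real_basicOpen, ih hS hM, hσM, List.length_cons]
    push_cast
    ring

theorem mem_basicOpen_of_prefix (h : τ <+: σ) (hX : X ∈ basicOpen (some σ)) :
    X ∈ basicOpen (some τ) := by
  change initSeg X τ.length = τ
  rw [← take_initSeg X h.length_le, show initSeg X σ.length = σ from hX,
    ← List.prefix_iff_eq_take.1 h]

theorem prefix_of_mem_basicOpen (h : τ.length ≤ σ.length) (hσ : X ∈ basicOpen (some σ))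
    (hτ : X ∈ basicOpen (some τ)) : τ <+: σ := by
  rw [List.prefix_iff_eq_take, ← show initSeg X σ.length = σ from hσ, take_initSeg X h]
  exact hτ.symm

/-- The strings of `S` whose cylinders are not seen to be covered by `T`, because they extend no
string of `T`. -/
def uncovered (T S : List (List Bool)) : List (List Bool) :=
  S.filter fun σ => ∀ τ ∈ T, ¬ τ <+: σ

theorem mem_uncovered : σ ∈ uncovered T S ↔ σ ∈ S ∧ ∀ τ ∈ T, ¬ τ <+: σ := by
  simp [uncovered]

theorem clopen_sdiff_subset_uncovered (T S : List (List Bool)) :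
    clopen S \ clopen T ⊆ clopen (uncovered T S) := by
  rintro X ⟨hS, hT⟩
  obtain ⟨σ, hσ, hX⟩ := mem_clopen.1 hS
  exact mem_clopen.2 ⟨σ, mem_uncovered.2
    ⟨hσ, fun τ hτ h => hT (mem_clopen.2 ⟨τ, hτ, mem_basicOpen_of_prefix h hX⟩)⟩, hX⟩

theorem clopen_uncovered (h : ∀ τ ∈ T, ∀ σ ∈ S, τ.length ≤ σ.length) :
    clopen (uncovered T S) = clopen S \ clopen T := by
  refine Set.Subset.antisymm (fun X hX => ?_) (clopen_sdiff_subset_uncovered T S)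
  obtain ⟨σ, hσ, hX⟩ := mem_clopen.1 hX
  obtain ⟨hσS, hσT⟩ := mem_uncovered.1 hσ
  refine ⟨mem_clopen.2 ⟨σ, hσS, hX⟩, fun hXT => ?_⟩
  obtain ⟨τ, hτ, hXτ⟩ := mem_clopen.1 hXT
  exact hσT τ hτ (prefix_of_mem_basicOpen (h τ hτ σ hσS) hX hXτ)

/-- The strings of length `M` in lexicographic order. -/
def strings : ℕ → List (List Bool)
  | 0 => [[]]
  | M + 1 => (strings M).flatMap fun σ => [σ ++ [false], σ ++ [true]]

theorem mem_strings : σ ∈ strings M ↔ σ.length = M := by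
  induction M generalizing σ with
  | zero => simp [strings]
  | succ M ih =>
    cases σ using List.reverseRecOn with
    | nil => simp [strings]
    | append_singleton σ b => cases b <;> simp [strings, ih]

theorem nodup_strings (M : ℕ) : (strings M).Nodup := by
  induction M with
  | zero => simp [strings]
  | succ M ih =>
    refine List.nodup_flatMap.2 ⟨fun σ _ => by simp, ih.imp fun {σ τ} h => ?_⟩
    simp [Function.onFun, List.disjoint_left, h]

theorem take_strings_succ (M j : ℕ) : (strings (M + 1)).take (2 * j) =
    ((strings M).take j).flatMap fun σ => [σ ++ [false], σ ++ [true]] := by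
  rw [strings]
  induction strings M generalizing j with
  | nil => simp
  | cons σ S ih =>
    cases j with
    | zero => simp
    | succ j => simp [Nat.mul_succ, ih]

/-- The union of the first `j` cylinders given by strings of length `M`. -/
def lowSet (M j : ℕ) : Set Cantor := clopen ((strings M).take j)

theorem lowSet_mono (M : ℕ) (h : i ≤ j) : lowSet M i ⊆ lowSet M j :=
  clopen_mono (List.take_subset_take_left _ h)

theorem lowSet_zero (M : ℕ) : lowSet M 0 = ∅ := by
  simp [lowSet, clopen]

theorem lowSet_length_strings (M : ℕ) : lowSet M (strings M).length = Set.univ :=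
  Set.eq_univ_of_forall fun X => mem_clopen.2
    ⟨initSeg X M, by simp [mem_strings], mem_basicOpen_initSeg X M⟩

theorem fairCoin_real_lowSet_succ_sdiff_le (M j : ℕ) :
    fairCoin.real (lowSet M (j + 1) \ lowSet M j) ≤ (1 / 2) ^ M := by
  rcases lt_or_ge j (strings M).length with hj | hj
  · have hsub : lowSet M (j + 1) \ lowSet M j ⊆ basicOpen (some (strings M)[j]) := by
      rintro X ⟨hX, hXj⟩
      obtain ⟨σ, hσ, hXσ⟩ := mem_clopen.1 hX
      rw [List.take_succ_eq_append_getElem hj, List.mem_append, List.mem_singleton] at hσ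
      rcases hσ with hσ | rfl
      · exact absurd (mem_clopen.2 ⟨σ, hσ, hXσ⟩) hXj
      · exact hXσ
    refine (measureReal_mono hsub).trans_eq ?_
    rw [fairCoin_real_basicOpen, mem_strings.1 (List.getElem_mem hj)]
  · simp [lowSet, List.take_of_length_le hj, List.take_of_length_le (hj.trans j.le_succ)]

theorem lowSet_add (M r j : ℕ) : lowSet (M + r) (2 ^ r * j) = lowSet M j := by
  induction r with
  | zero => simp
  | succ r ih =>
    rw [← ih, pow_succ', mul_assoc, lowSet, ← add_assoc, take_strings_succ, clopen_flatMap_split,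
      lowSet]

theorem lowSet_total (M i N j : ℕ) : lowSet M i ⊆ lowSet N j ∨ lowSet N j ⊆ lowSet M i := by
  rw [← lowSet_add M N i, ← lowSet_add N M j, Nat.add_comm N M]
  exact (le_total _ _).imp (lowSet_mono _) (lowSet_mono _)

/-- The union of the intervals `lowSet M j` whose union with `U` has measure below `δ`. -/
def fillSet (U : Set Cantor) (δ : ℝ) : Set Cantor :=
  ⋃ p ∈ {p : ℕ × ℕ | fairCoin.real (U ∪ lowSet p.1 p.2) < δ}, lowSet p.1 p.2

variable {U : Set Cantor} {δ : ℝ}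

theorem exists_lt_real_union_lowSet (hU : fairCoin.real U < δ) (hδ : δ ≤ 1) (M : ℕ) :
    ∃ j, fairCoin.real (U ∪ lowSet M j) < δ ∧
      δ ≤ fairCoin.real (U ∪ lowSet M j) + (1 / 2) ^ M := by
  have hex : ∃ j, δ ≤ fairCoin.real (U ∪ lowSet M j) :=
    ⟨(strings M).length, by simpa [lowSet_length_strings] using hδ⟩
  classical
  obtain ⟨j, hj⟩ : ∃ j, Nat.find hex = j + 1 := Nat.exists_eq_succ_of_ne_zero fun h => by
    have := Nat.find_spec hex
    rw [h, lowSet_zero, Set.union_empty] at this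
    exact this.not_gt hU
  refine ⟨j, not_le.1 (Nat.find_min hex (hj ▸ j.lt_succ_self)), ?_⟩
  have hsub : U ∪ lowSet M (j + 1) ⊆ (U ∪ lowSet M j) ∪ (lowSet M (j + 1) \ lowSet M j) := by
    rw [Set.union_assoc, Set.union_sdiff_self]
    exact Set.union_subset_union_right U Set.subset_union_right
  calc δ ≤ fairCoin.real (U ∪ lowSet M (j + 1)) := hj ▸ Nat.find_spec hex
    _ ≤ _ := (measureReal_mono hsub).trans (measureReal_union_le _ _)
    _ ≤ _ := by gcongr; exact fairCoin_real_lowSet_succ_sdiff_le M j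

theorem fairCoin_real_union_fillSet (hU : fairCoin.real U ≤ δ) (hδ : δ ≤ 1) :
    fairCoin.real (U ∪ fillSet U δ) = δ := by
  rcases hU.eq_or_lt with rfl | hU
  · have hempty : fillSet U (fairCoin.real U) = ∅ :=
      Set.subset_empty_iff.1 <| Set.iUnion₂_subset fun p hp => absurd
        (measureReal_mono (Set.subset_union_left (t := lowSet p.1 p.2))) (not_le.2 hp)
    rw [hempty, Set.union_empty]
  refine le_antisymm ?_ (le_of_forall_pos_le_add fun ε hε => ?_)
  · let I := {p : ℕ × ℕ | fairCoin.real (U ∪ lowSet p.1 p.2) < δ}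
    have : Nonempty I := ⟨(0, 0), by simpa [I, lowSet_zero] using hU⟩
    have hdir : Directed (· ⊆ ·) fun p : I => U ∪ lowSet p.1.1 p.1.2 := fun p q =>
      (lowSet_total p.1.1 p.1.2 q.1.1 q.1.2).elim
        (fun h => ⟨q, Set.union_subset_union_right U h, subset_rfl⟩)
        fun h => ⟨p, subset_rfl, Set.union_subset_union_right U h⟩
    have hunion : U ∪ fillSet U δ = ⋃ p : I, U ∪ lowSet p.1.1 p.1.2 := by
      rw [fillSet, Set.biUnion_eq_iUnion, Set.union_iUnion]
    refine ENNReal.toReal_le_of_le_ofReal (measureReal_nonneg.trans hU.le) ?_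
    rw [hunion, hdir.measure_iUnion]
    exact iSup_le fun p => (ofReal_measureReal (measure_ne_top _ _)).symm.trans_le
      (ENNReal.ofReal_le_ofReal p.2.le)
  · obtain ⟨M, hM⟩ := exists_pow_lt_of_lt_one hε (one_half_lt_one (α := ℝ))
    obtain ⟨j, hj, hjM⟩ := exists_lt_real_union_lowSet hU hδ M
    have hsub : lowSet M j ⊆ fillSet U δ :=
      Set.subset_biUnion_of_mem (u := fun p : ℕ × ℕ => lowSet p.1 p.2) (x := (M, j)) hj
    exact hjM.trans (add_le_add (measureReal_mono (Set.union_subset_union_right U hsub)) hM.le)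

end Intervals

/-! ### Filling up the levels of a Schnorr test -/

section RationalComputations

variable {α : Type} [Primcodable α] {f g : α → ℚ}

/-- Primitive recursive rational-valued functions: a name of the value is computed. -/
def PrimrecRat (f : α → ℚ) : Prop :=
  ∃ p : α → ℕ × ℕ × ℕ, Primrec p ∧ ∀ a, ratOfCode (p a) = f a

theorem primrecRat_ratOfCode {p : α → ℕ × ℕ × ℕ} (hp : Primrec p) :
    PrimrecRat fun a => ratOfCode (p a) :=
  ⟨p, hp, fun _ => rfl⟩

theorem PrimrecRat.add (hf : PrimrecRat f) (hg : PrimrecRat g) :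
    PrimrecRat fun a => f a + g a := by
  obtain ⟨p, hp, hpf⟩ := hf
  obtain ⟨q, hq, hqg⟩ := hg
  have hd : Primrec fun a => (p a).2.2 := .comp .snd (.comp .snd hp)
  have hd' : Primrec fun a => (q a).2.2 := .comp .snd (.comp .snd hq)
  have hcross : ∀ {m n : α → ℕ}, Primrec m → Primrec n →
      Primrec fun a => m a * ((q a).2.2 + 1) + n a * ((p a).2.2 + 1) := fun hm hn =>
    Primrec.nat_add.comp (Primrec.nat_mul.comp hm (Primrec.succ.comp hd'))
      (Primrec.nat_mul.comp hn (Primrec.succ.comp hd))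
  refine ⟨_, (hcross (.comp .fst hp) (.comp .fst hq)).pair
    ((hcross (.comp .fst (.comp .snd hp)) (.comp .fst (.comp .snd hq))).pair
      (Primrec.nat_add.comp (Primrec.nat_mul.comp hd hd') (Primrec.nat_add.comp hd hd'))),
    fun a => ?_⟩
  simp only [← hpf, ← hqg, ratOfCode]
  push_cast
  have h : ((p a).2.2 : ℚ) * (q a).2.2 + ((p a).2.2 + (q a).2.2) + 1 =
      ((p a).2.2 + 1) * ((q a).2.2 + 1) := by ring
  rw [h]
  field_simp
  ring

theorem PrimrecRat.lt (hf : PrimrecRat f) (hg : PrimrecRat g) :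
    PrimrecPred fun a => f a < g a := by
  obtain ⟨p, hp, hpf⟩ := hf
  obtain ⟨q, hq, hqg⟩ := hg
  have hcross : ∀ {p q : α → ℕ × ℕ × ℕ}, Primrec p → Primrec q →
      Primrec fun a => (p a).1 * ((q a).2.2 + 1) + (q a).2.1 * ((p a).2.2 + 1) := fun hp hq =>
    Primrec.nat_add.comp
      (Primrec.nat_mul.comp (.comp .fst hp) (Primrec.succ.comp (.comp .snd (.comp .snd hq))))
      (Primrec.nat_mul.comp (.comp .fst (.comp .snd hq))
        (Primrec.succ.comp (.comp .snd (.comp .snd hp))))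
  refine (Primrec.nat_lt.comp (hcross hp hq) (hcross hq hp)).of_eq fun a => ?_
  rw [← hpf, ← hqg, ratOfCode, ratOfCode, div_lt_div_iff₀ (by positivity) (by positivity),
    ← Nat.cast_lt (α := ℚ)]
  push_cast
  constructor <;> intro h <;> linarith

/-- A name of the dyadic rational `N / 2 ^ M`. -/
def dyadic (N M : ℕ) : ℕ × ℕ × ℕ := (N, 0, 2 ^ M - 1)

theorem ratOfCode_dyadic (N M : ℕ) : ratOfCode (dyadic N M) = N * (1 / 2) ^ M := by
  simp [ratOfCode, dyadic, Nat.cast_sub Nat.one_le_two_pow, div_eq_mul_inv]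

theorem primrec_dyadic : Primrec₂ dyadic := by
  have hpow : Primrec₂ ((· ^ ·) : ℕ → ℕ → ℕ) :=
    Primrec₂.unpaired'.1 Nat.Primrec.pow
  exact Primrec.fst.pair ((Primrec.const 0).pair
    (Primrec.nat_sub.comp (hpow.comp (Primrec.const 2) Primrec.snd) (Primrec.const 1)))

theorem primrecRat_mul_half_pow {N M : α → ℕ} (hN : Primrec N) (hM : Primrec M) :
    PrimrecRat fun a => (N a : ℚ) * (1 / 2) ^ M a :=
  ⟨_, primrec_dyadic.comp hN hM, fun _ => ratOfCode_dyadic _ _⟩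

theorem primrecRat_half_pow {M : α → ℕ} (hM : Primrec M) :
    PrimrecRat fun a => (1 / 2 : ℚ) ^ M a := by
  simpa using primrecRat_mul_half_pow (Primrec.const 1) hM

end RationalComputations

section PrimrecStrings

theorem primrec_strings : Primrec strings := by
  have hchildren : Primrec₂ fun (_ : ℕ) (L : List (List Bool)) =>
      L.flatMap fun σ => [σ ++ [false], σ ++ [true]] := by
    refine Primrec.list_flatMap Primrec.snd ?_
    have happend : ∀ b : Bool, Primrec fun p : (ℕ × List (List Bool)) × List Bool => p.2 ++ [b] :=
      fun b => Primrec.list_concat.comp Primrec.snd (Primrec.const b)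
    exact Primrec.list_cons.comp (happend false)
      (Primrec.list_cons.comp (happend true) (Primrec.const []))
  refine (Primrec.nat_rec₁ [[]] hchildren).of_eq fun M => ?_
  induction M with
  | zero => rfl
  | succ M ih => exact congrArg (List.flatMap _) ih

theorem primrecRel_prefix : PrimrecRel fun τ σ : List Bool => τ <+: σ :=
  (Primrec.eq.comp Primrec.fst (Primrec.list_take.comp (Primrec.list_length.comp Primrec.fst)
    Primrec.snd)).of_eq fun _ => List.prefix_iff_eq_take.symm

theorem primrec_uncovered : Primrec₂ uncovered := by
  have hrel : PrimrecRel fun (σ : List Bool) (T : List (List Bool)) => ∀ τ ∈ T, ¬ τ <+: σ :=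
    (PrimrecRel.forall_mem_list (PrimrecRel.not primrecRel_prefix)).comp Primrec.snd Primrec.fst
  exact hrel.listFilter.comp Primrec.snd Primrec.fst

end PrimrecStrings

section FillCode

variable {c : TestCode} {O : Set (ℕ →. ℕ)} {n s M j M₀ j₀ : ℕ}

/-- The strings among the first `s` entries of the listing of the `n`-th open set. -/
def TestCode.listed (c : TestCode) (n s : ℕ) : List (List Bool) :=
  (List.range s).filterMap fun i => (c (n, i)).1

theorem mem_listed {σ : List Bool} : σ ∈ c.listed n s ↔ ∃ i < s, (c (n, i)).1 = some σ := by
  simp [TestCode.listed]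

theorem clopen_listed (c : TestCode) (n s : ℕ) :
    clopen (c.listed n s) = ⋃ i < s, basicOpen (c (n, i)).1 := by
  ext X
  simp only [mem_clopen, mem_listed, Set.mem_iUnion, exists_prop]
  constructor
  · rintro ⟨σ, ⟨i, hi, hσ⟩, hX⟩
    exact ⟨i, hi, hσ ▸ hX⟩
  · rintro ⟨i, hi, hX⟩
    cases hσ : (c (n, i)).1 with
    | none => simp [hσ, basicOpen] at hX
    | some σ => exact ⟨σ, ⟨i, hi, hσ⟩, hσ ▸ hX⟩

theorem clopen_listed_subset (c : TestCode) (n s : ℕ) : clopen (c.listed n s) ⊆ c.level n := by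
  rw [clopen_listed]
  exact Set.iUnion₂_subset fun i _ => Set.subset_iUnion (fun i => basicOpen (c (n, i)).1) i

theorem isOpen_level (c : TestCode) (n : ℕ) : IsOpen (c.level n) :=
  isOpen_openOfCode _

/-- A finite computation shows that `lowSet M j` can be added to the `n`-th open set while keeping
the measure below `2 ^ (-n)`: here `L` consists of strings listed so far, and the rational named by
`q` approximates the measure from below up to an error of `2 ^ (-s)`. -/
def Admissible (L : List (List Bool)) (q : ℕ × ℕ × ℕ) (n s M j : ℕ) : Prop :=
  (uncovered L ((strings M).take j)).length * (1 / 2) ^ M + ratOfCode q + (1 / 2) ^ s <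
    (1 / 2 : ℚ) ^ n

instance (L : List (List Bool)) (q : ℕ × ℕ × ℕ) (n s M j : ℕ) :
    Decidable (Admissible L q n s M j) :=
  inferInstanceAs (Decidable (_ < _))

theorem admissible_iff {L : List (List Bool)} {q : ℕ × ℕ × ℕ} : Admissible L q n s M j ↔
    (uncovered L ((strings M).take j)).length * (1 / 2) ^ M + (ratOfCode q : ℝ) + (1 / 2) ^ s <
      (1 / 2) ^ n := by
  rw [Admissible, ← Rat.cast_lt (K := ℝ)]
  push_cast
  rfl

theorem primrecPred_admissible {α : Type} [Primcodable α] {L : α → List (List Bool)}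
    {q : α → ℕ × ℕ × ℕ} {n s M j : α → ℕ} (hL : Primrec L) (hq : Primrec q) (hn : Primrec n)
    (hs : Primrec s) (hM : Primrec M) (hj : Primrec j) :
    PrimrecPred fun a => Admissible (L a) (q a) (n a) (s a) (M a) (j a) :=
  (((primrecRat_mul_half_pow (Primrec.list_length.comp (primrec_uncovered.comp hL
    (Primrec.list_take.comp hj (primrec_strings.comp hM)))) hM).add (primrecRat_ratOfCode hq)).add
      (primrecRat_half_pow hs)).lt (primrecRat_half_pow hn)

/-- A list of basic open sets for `c.level n` filled up to measure `2 ^ (-n)`: stage `(s, j, τ)`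
lists `[τ]` if `τ` is among the first `j` strings of its length and these are admissible, and the
`s`-th basic open set of `c.level n` otherwise. -/
def fillCode (c : TestCode) : ℕ × ℕ × ℕ × List Bool → Option (List Bool) := fun (n, s, j, τ) =>
  if τ ∈ (strings τ.length).take j ∧ Admissible (c.listed n s) (c (n, s)).2 n s τ.length j
  then some τ else (c (n, s)).1

theorem computableIn_fillCode (hc : ComputableIn O c) : ComputableIn O (fillCode c) := by
  let G : (ℕ × ℕ × ℕ × List Bool) × (Option (List Bool) × ℕ × ℕ × ℕ) ×
      List (Option (List Bool) × ℕ × ℕ × ℕ) → Option (List Bool) := fun a =>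
    if a.1.2.2.2 ∈ (strings a.1.2.2.2.length).take a.1.2.2.1 ∧
      Admissible (a.2.2.filterMap Prod.fst) a.2.1.2 a.1.1 a.1.2.1 a.1.2.2.2.length a.1.2.2.1
    then some a.1.2.2.2 else a.2.1.1
  have hG : Primrec G := by
    have hmem : PrimrecRel fun (σ : List Bool) (S : List (List Bool)) => σ ∈ S :=
      ((PrimrecRel.exists_mem_list Primrec.eq).comp Primrec.snd Primrec.fst).of_eq fun _ => by simp
    have hτ : Primrec fun a : (ℕ × ℕ × ℕ × List Bool) × (Option (List Bool) × ℕ × ℕ × ℕ) ×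
        List (Option (List Bool) × ℕ × ℕ × ℕ) => a.1.2.2.2 :=
      .comp .snd (.comp .snd (.comp .snd .fst))
    have hj : Primrec fun a : (ℕ × ℕ × ℕ × List Bool) × (Option (List Bool) × ℕ × ℕ × ℕ) ×
        List (Option (List Bool) × ℕ × ℕ × ℕ) => a.1.2.2.1 :=
      .comp .fst (.comp .snd (.comp .snd .fst))
    have hM := Primrec.list_length.comp hτ
    refine Primrec.ite (PrimrecPred.and
      (hmem.comp hτ (Primrec.list_take.comp hj (primrec_strings.comp hM)))
      (primrecPred_admissible (Primrec.listFilterMap (.comp .snd .snd)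
        (Primrec.fst.comp Primrec.snd))
        (.comp .snd (.comp .fst .snd)) (.comp .fst .fst) (.comp .fst (.comp .snd .fst)) hM hj))
      (Primrec.option_some.comp hτ) (.comp .fst (.comp .fst .snd))
  have hns : Computable fun a : ℕ × ℕ × ℕ × List Bool => (a.1, a.2.1) :=
    Computable.fst.pair (Computable.fst.comp Computable.snd)
  convert computableIn_comp hG.to_comp.computableIn (computableIn_prodMk ComputableIn.id
    (computableIn_prodMk (computableIn_comp hc hns.computableIn)
      (computableIn_comp (computableIn_range_map hc) hns.computableIn))) with a
  obtain ⟨n, s, j, τ⟩ := a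
  simp only [G, fillCode, TestCode.listed, List.filterMap_map, Function.comp_def, id_eq]
  congr

theorem IsSchnorrTest.abs_approx_sub_le (hc : IsSchnorrTest c) (n s : ℕ) :
    |(c.approx n s : ℝ) - fairCoin.real (c.level n)| ≤ (1 / 2) ^ s := by
  obtain ⟨-, hfast, hlim⟩ := hc n
  rw [abs_sub_comm]
  refine le_of_tendsto (hlim.sub_const _).abs ?_
  filter_upwards [eventually_ge_atTop s] with m hm
  simpa using (Rat.cast_le (K := ℝ)).2 (hfast s m hm)

theorem IsSchnorrTest.real_level_le (hc : IsSchnorrTest c) (n : ℕ) :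
    fairCoin.real (c.level n) ≤ (1 / 2) ^ n :=
  fairCoin_le_iff_real.1 (hc n).1

theorem IsSchnorrTest.real_union_lt_of_admissible (hc : IsSchnorrTest c)
    (h : Admissible (c.listed n s) (c (n, s)).2 n s M j) :
    fairCoin.real (c.level n ∪ lowSet M j) < (1 / 2) ^ n := by
  set S := (strings M).take j
  have hcount : fairCoin.real (clopen (uncovered (c.listed n s) S)) =
      (uncovered (c.listed n s) S).length * (1 / 2) ^ M :=
    fairCoin_real_clopen (((nodup_strings M).sublist (List.take_sublist _ _)).filter _)
      fun σ hσ => mem_strings.1 (List.mem_of_mem_take (mem_uncovered.1 hσ).1)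
  have hsub : c.level n ∪ lowSet M j ⊆ c.level n ∪ clopen (uncovered (c.listed n s) S) := by
    rw [← Set.union_sdiff_self]
    exact Set.union_subset_union_right _ ((Set.sdiff_subset_sdiff_right
      (clopen_listed_subset c n s)).trans (clopen_sdiff_subset_uncovered _ _))
  have hlevel := (abs_le.1 (hc.abs_approx_sub_le n s)).1
  rw [TestCode.approx] at hlevel
  linarith [admissible_iff.1 h, (measureReal_mono (μ := fairCoin) hsub).trans
    (measureReal_union_le _ _)]

theorem tendsto_real_sdiff_listed {P : Set Cantor} (hP : MeasurableSet P) (c : TestCode) (n : ℕ) :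
    Tendsto (fun s => fairCoin.real (P \ clopen (c.listed n s))) atTop
      (𝓝 (fairCoin.real (P \ c.level n))) := by
  have hanti : Antitone fun s => P \ clopen (c.listed n s) := fun s t hst =>
    Set.sdiff_subset_sdiff_right <| by
      simp only [clopen_listed]
      exact Set.biUnion_subset_biUnion_left fun i hi => lt_of_lt_of_le hi hst
  have hlevel : c.level n = ⋃ s, clopen (c.listed n s) := by
    refine (Set.iUnion_subset fun i => ?_).antisymm
      (Set.iUnion_subset fun s => clopen_listed_subset c n s)
    refine Set.subset_iUnion_of_subset (i + 1) ?_
    rw [clopen_listed]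
    exact Set.subset_biUnion_of_mem (u := fun i => basicOpen (c (n, i)).1) i.lt_succ_self
  rw [hlevel, Set.sdiff_iUnion]
  exact (ENNReal.tendsto_toReal (measure_ne_top _ _)).comp (tendsto_measure_iInter_atTop
    (fun s => (hP.diff (isOpen_clopen _).measurableSet).nullMeasurableSet) hanti
    ⟨0, measure_ne_top _ _⟩)

theorem IsSchnorrTest.exists_admissible (hc : IsSchnorrTest c)
    (h : fairCoin.real (c.level n ∪ lowSet M₀ j₀) < (1 / 2) ^ n) :
    ∃ s M j, lowSet M j = lowSet M₀ j₀ ∧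
      Admissible (c.listed n s) (c (n, s)).2 n s M j := by
  have hlow : MeasurableSet (lowSet M₀ j₀) := (isOpen_clopen _).measurableSet
  have hlim : Tendsto (fun s => fairCoin.real (lowSet M₀ j₀ \ clopen (c.listed n s)) +
      (c.approx n s : ℝ) + (1 / 2) ^ s) atTop
      (𝓝 (fairCoin.real (c.level n ∪ lowSet M₀ j₀))) := by
    rw [← Set.union_sdiff_self, measureReal_union Set.disjoint_sdiff_right
      (hlow.diff (isOpen_level c n).measurableSet), add_comm]
    simpa [Measure.real] using ((tendsto_real_sdiff_listed hlow c n).add (hc n).2.2).add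
      (tendsto_pow_atTop_nhds_zero_of_lt_one (one_half_pos (α := ℝ)).le one_half_lt_one)
  obtain ⟨s, hs⟩ := (hlim.eventually_lt_const h).exists
  obtain ⟨r, hr⟩ : ∃ r, ∀ τ ∈ c.listed n s, τ.length ≤ r :=
    ⟨_, fun τ hτ => List.single_le_sum (by simp) _ (List.mem_map_of_mem (f := List.length) hτ)⟩
  refine ⟨s, M₀ + r, 2 ^ r * j₀, lowSet_add M₀ r j₀, ?_⟩
  set S := (strings (M₀ + r)).take (2 ^ r * j₀)
  have hS : ∀ σ ∈ S, σ.length = M₀ + r := fun σ hσ => mem_strings.1 (List.mem_of_mem_take hσ)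
  have hcount : fairCoin.real (lowSet M₀ j₀ \ clopen (c.listed n s)) =
      (uncovered (c.listed n s) S).length * (1 / 2) ^ (M₀ + r) := by
    rw [← lowSet_add M₀ r j₀, lowSet, ← clopen_uncovered fun τ hτ σ hσ =>
      ((hr τ hτ).trans (Nat.le_add_left r M₀)).trans (hS σ hσ).ge]
    exact fairCoin_real_clopen (((nodup_strings _).sublist (List.take_sublist _ _)).filter _)
      fun σ hσ => hS σ (mem_uncovered.1 hσ).1
  rw [hcount] at hs
  exact admissible_iff.2 hs

theorem IsSchnorrTest.iUnion_fillCode (hc : IsSchnorrTest c) (n : ℕ) :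
    ⋃ i, basicOpen (fillCode c (n, i)) = c.level n ∪ fillSet (c.level n) ((1 / 2) ^ n) := by
  refine Set.Subset.antisymm ?_ (Set.union_subset ?_ ?_)
  · rw [Set.iUnion_subset_iff]
    rintro ⟨s, j, τ⟩
    by_cases h : τ ∈ (strings τ.length).take j ∧
        Admissible (c.listed n s) (c (n, s)).2 n s τ.length j
    · rw [fillCode, if_pos h]
      refine (Set.subset_biUnion_of_mem (s := {σ | σ ∈ (strings τ.length).take j})
        (u := fun σ => basicOpen (some σ)) h.1).trans
        (Set.subset_union_of_subset_right ?_ _)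
      exact Set.subset_biUnion_of_mem (u := fun p : ℕ × ℕ => lowSet p.1 p.2)
        (x := (τ.length, j)) (hc.real_union_lt_of_admissible h.2)
    · rw [fillCode, if_neg h]
      exact Set.subset_union_of_subset_left
        (Set.subset_iUnion (fun s => basicOpen (c (n, s)).1) s) _
  · refine Set.iUnion_subset fun s => Set.subset_iUnion_of_subset (s, 0, []) ?_
    simp [fillCode]
  · refine Set.iUnion₂_subset fun p hp => ?_
    obtain ⟨s, M, j, hlow, hadm⟩ := hc.exists_admissible hp
    rw [← hlow]
    refine Set.iUnion₂_subset fun τ hτ => Set.subset_iUnion_of_subset (s, j, τ) ?_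
    have hM : τ.length = M := mem_strings.1 (List.mem_of_mem_take hτ)
    rw [fillCode, if_pos ⟨hM ▸ hτ, hM ▸ hadm⟩]

end FillCode

section Equivalence

variable {A B : Cantor}

theorem exists_ttTest_of_schnorrTest {c : TestCode} (hc : ComputableIn (oracle B) c)
    (htest : IsSchnorrTest c) :
    ∃ C : ℕ × ℕ → Option (List Bool), TTReducible C B ∧ ∀ n,
      fairCoin (openOfCode fun s => C (n, s)) = (2⁻¹ : ℝ≥0∞) ^ n ∧
        c.level n ⊆ openOfCode fun s => C (n, s) := by
  obtain ⟨C, hC, hCn⟩ := exists_ttReducible_openOfCode_eq (computableIn_fillCode hc)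
  refine ⟨C, hC, fun n => ?_⟩
  rw [hCn, htest.iUnion_fillCode, fairCoin_eq_iff_real]
  exact ⟨fairCoin_real_union_fillSet (htest.real_level_le n)
    (pow_le_one₀ one_half_pos.le one_half_lt_one.le), Set.subset_union_left⟩

theorem fastCauchy_const (q : ℚ) : FastCauchy fun _ => q := fun k m _ => by
  simp

theorem isSchnorrTest_of_fairCoin_eq {c : TestCode}
    (hc : ∀ n, fairCoin (c.level n) = (2⁻¹ : ℝ≥0∞) ^ n)
    (happrox : ∀ n s, c.approx n s = (1 / 2) ^ n) :
    IsSchnorrTest c := fun n => by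
  have hconst : c.approx n = fun _ => (1 / 2) ^ n := funext (happrox n)
  refine ⟨(hc n).le, hconst ▸ fastCauchy_const _, ?_⟩
  rw [hconst]
  change Tendsto _ _ (𝓝 (fairCoin.real (c.level n)))
  rw [fairCoin_eq_iff_real.1 (hc n)]
  simp

theorem ttTestSchnorrRandomRelativeTo_iff :
    TTTestSchnorrRandomRelativeTo A B ↔ SchnorrRandomRelativeTo A B := by
  refine not_congr ⟨fun ⟨C, hC, hμ, hA⟩ => ?_, fun ⟨c, hc, htest, hA⟩ => ?_⟩
  · have hdyadic : Computable fun p : ℕ × ℕ => dyadic 1 p.1 :=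
      (primrec_dyadic.comp (Primrec.const 1) Primrec.fst).to_comp
    exact ⟨fun p => (C p, dyadic 1 p.1), computableIn_prodMk hC.computableIn hdyadic.computableIn,
      isSchnorrTest_of_fairCoin_eq hμ fun n s => by simp [TestCode.approx, ratOfCode_dyadic], hA⟩
  · obtain ⟨C, hC, hCn⟩ := exists_ttTest_of_schnorrTest hc htest
    exact ⟨C, hC, fun n => (hCn n).1, fun n => (hCn n).2 (hA n)⟩

end Equivalence

/-! ### Semicontinuity of uniform tests -/

section Semicontinuity

variable {α σ : Type} [Primcodable α] [Primcodable σ] {V W : Cantor → Set Cantor}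

theorem TotalComputableFunctional.eventually_eq {Φ : Cantor → α → σ}
    (hΦ : TotalComputableFunctional Φ) (X : Cantor) (a : α) : ∀ᶠ Y in 𝓝 X, Φ Y a = Φ X a := by
  obtain ⟨φ, -, h⟩ := hΦ
  obtain ⟨k, hk⟩ := (h X a).1
  filter_upwards [(hasAntitoneBasis_cylinder X).mem k] with Y hY
  rw [← initSeg_eq_initSeg_iff.2 hY] at hk
  exact ((h Y a).2 k _ hk).symm

/-- Upper semicontinuity of a set-valued map up to sets of small measure. -/
def AlmostUpperSemicontinuous (W : Cantor → Set Cantor) : Prop :=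
  ∀ X, Tendsto (fun Y => fairCoin.real (W Y \ W X)) (𝓝 X) (𝓝 0)

theorem AlmostUpperSemicontinuous.union (hV : AlmostUpperSemicontinuous V)
    (hW : AlmostUpperSemicontinuous W) : AlmostUpperSemicontinuous fun X => V X ∪ W X := by
  intro X
  have hsum := (hV X).add (hW X)
  rw [add_zero] at hsum
  refine squeeze_zero (fun _ => measureReal_nonneg) (fun Y => ?_) hsum
  refine (measureReal_mono ?_).trans (measureReal_union_le _ _)
  rw [Set.union_sdiff_distrib]
  exact Set.union_subset_union (Set.sdiff_subset_sdiff_right Set.subset_union_left)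
    (Set.sdiff_subset_sdiff_right Set.subset_union_right)

theorem AlmostUpperSemicontinuous.eventually_pos (hW : AlmostUpperSemicontinuous W)
    {P : Set Cantor} {X : Cantor} (h : 0 < fairCoin.real (P \ W X)) :
    ∀ᶠ Y in 𝓝 X, 0 < fairCoin.real (P \ W Y) := by
  filter_upwards [(hW X).eventually_lt_const h] with Y hY
  have hsub : P \ W X ⊆ (P \ W Y) ∪ (W Y \ W X) := fun Z ⟨hZ, hZX⟩ =>
    (em (Z ∈ W Y)).elim (fun hZY => Or.inr ⟨hZY, hZX⟩) fun hZY => Or.inl ⟨hZ, hZY⟩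
  linarith [(measureReal_mono (μ := fairCoin) hsub).trans (measureReal_union_le _ _)]

theorem IsUniformSchnorrTest.continuous_real_level {Φ : Cantor → TestCode}
    (hΦ : IsUniformSchnorrTest Φ) (n : ℕ) :
    Continuous fun X => fairCoin.real ((Φ X).level n) := by
  have happrox : ∀ s, Continuous fun X => ((Φ X).approx n s : ℝ) := fun s =>
    continuous_iff_continuousAt.2 fun X => tendsto_const_nhds.congr' <| by
      filter_upwards [hΦ.1.eventually_eq X (n, s)] with Y hY
      rw [TestCode.approx, TestCode.approx, hY]
  have hunif : TendstoUniformly (fun s X => ((Φ X).approx n s : ℝ))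
      (fun X => fairCoin.real ((Φ X).level n)) atTop := by
    refine Metric.tendstoUniformly_iff.2 fun ε hε => ?_
    filter_upwards [(tendsto_pow_atTop_nhds_zero_of_lt_one (one_half_pos (α := ℝ)).le
      one_half_lt_one).eventually_lt_const hε] with s hs X
    rw [dist_comm, Real.dist_eq]
    exact ((hΦ.2 X).abs_approx_sub_le n s).trans_lt hs
  exact hunif.continuous (.of_forall happrox)

theorem IsUniformSchnorrTest.almostUpperSemicontinuous {Φ : Cantor → TestCode}
    (hΦ : IsUniformSchnorrTest Φ) (n : ℕ) :
    AlmostUpperSemicontinuous fun X => (Φ X).level n := by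
  intro X
  refine tendsto_order.2 ⟨fun ε hε => .of_forall fun Y => hε.trans_le measureReal_nonneg,
    fun ε hε => ?_⟩
  have hlisted : Tendsto (fun s => fairCoin.real ((Φ X).level n \ clopen ((Φ X).listed n s))) atTop
      (𝓝 0) := by
    simpa using tendsto_real_sdiff_listed (isOpen_level (Φ X) n).measurableSet (Φ X) n
  obtain ⟨s, hs⟩ := (hlisted.eventually_lt_const (half_pos hε)).exists
  have hlevel : ∀ᶠ Y in 𝓝 X, fairCoin.real ((Φ Y).level n) <
      fairCoin.real ((Φ X).level n) + ε / 2 :=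
    (hΦ.continuous_real_level n).continuousAt.eventually_lt_const
      (lt_add_of_pos_right _ (half_pos hε))
  have hsame : ∀ᶠ Y in 𝓝 X, ∀ i ∈ Finset.range s, Φ Y (n, i) = Φ X (n, i) :=
    (Filter.eventually_all_finset _).2 fun i _ => hΦ.1.eventually_eq X (n, i)
  filter_upwards [hlevel, hsame] with Y hYlevel hYsame
  have hD : clopen ((Φ Y).listed n s) = clopen ((Φ X).listed n s) := by
    simp only [clopen_listed]
    exact Set.iUnion₂_congr fun i hi => by rw [hYsame i (Finset.mem_range.2 hi)]
  have hDmeas := (isOpen_clopen ((Φ X).listed n s)).measurableSet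
  have hDX := clopen_listed_subset (Φ X) n s
  have hDY : clopen ((Φ X).listed n s) ⊆ (Φ Y).level n := hD ▸ clopen_listed_subset (Φ Y) n s
  rw [measureReal_sdiff hDX hDmeas] at hs
  have hsub := measureReal_mono (μ := fairCoin) (Set.sdiff_subset_sdiff_right
    (s := (Φ Y).level n) hDX)
  rw [measureReal_sdiff hDY hDmeas] at hsub
  linarith

end Semicontinuity

/-! ### The separation -/

section Countability

open Encodable

variable {α σ : Type} [Primcodable α] [Primcodable σ]

theorem countable_setOf_computable : {f : α → σ | Computable f}.Countable := by
  have hcode : {f : α → σ | Computable f} ⊆ ⋃ e : Nat.Partrec.Code,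
      {f | ∀ a, e.eval (encode a) = Part.some (encode (f a))} := fun f hf => by
    obtain ⟨e, he⟩ := Nat.Partrec.Code.exists_code.1 (show Nat.Partrec _ from hf)
    exact Set.mem_iUnion.2 ⟨e, fun a => by rw [he]; simp⟩
  refine (Set.countable_iUnion fun e => Set.Subsingleton.countable ?_).mono hcode
  exact fun f hf g hg => funext fun a =>
    encode_injective (Part.some_injective ((hf a).symm.trans (hg a)))

theorem countable_setOf_totalComputableFunctional :
    {Φ : Cantor → α → σ | TotalComputableFunctional Φ}.Countable := by
  have huse : {Φ : Cantor → α → σ | TotalComputableFunctional Φ} ⊆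
      ⋃ φ ∈ {φ : List Bool × α → Option σ | Computable φ},
        {Φ | ∀ X a, (∃ k, φ (initSeg X k, a) = some (Φ X a)) ∧
          ∀ k v, φ (initSeg X k, a) = some v → v = Φ X a} := by
    rintro Φ ⟨φ, hφ, h⟩
    exact Set.mem_biUnion (x := fun p : List Bool × α => φ p.1 p.2) hφ h
  refine (countable_setOf_computable.biUnion fun φ _ => Set.Subsingleton.countable ?_).mono huse
  intro Φ hΦ Ψ hΨ
  funext X a
  obtain ⟨k, hk⟩ := (hΦ X a).1
  exact (hΨ X a).2 k _ hk

end Countability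

section Separation

variable {A B : Cantor}

theorem not_schnorrRandomRelativeTo_of_computableIn (hA : ComputableIn (oracle B) A) :
    ¬ SchnorrRandomRelativeTo A B := by
  have hseg : ComputableIn (oracle B) fun p : ℕ × ℕ => initSeg A p.1 :=
    computableIn_comp (f := fun p : ℕ × ℕ => ((), p.1))
      (computableIn_range_map (computableIn_comp hA ComputableIn.snd))
      (computableIn_prodMk (ComputableIn.const ()) ComputableIn.fst)
  have hcode : Computable fun q : List Bool × ℕ => (some q.1, dyadic 1 q.2) :=
    ((Primrec.option_some.comp Primrec.fst).pair
      (primrec_dyadic.comp (Primrec.const 1) Primrec.snd)).to_comp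
  let c : TestCode := fun p => (some (initSeg A p.1), dyadic 1 p.1)
  have hlevel : ∀ n, c.level n = basicOpen (some (initSeg A n)) := fun n =>
    Set.iUnion_const (ι := ℕ) (basicOpen (some (initSeg A n)))
  refine fun h => h ⟨c, computableIn_comp hcode.computableIn
    (computableIn_prodMk hseg ComputableIn.fst), isSchnorrTest_of_fairCoin_eq (fun n => ?_)
    fun n s => by simp [c, TestCode.approx, ratOfCode_dyadic], fun n => ?_⟩
  · rw [hlevel, fairCoin_eq_iff_real, fairCoin_real_basicOpen, length_initSeg]
  · exact hlevel n ▸ mem_basicOpen_initSeg A n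

/-- The elements of an oracle by which it announces the `s`-th bit `b` of another sequence; `j` is
a padding parameter that makes them arbitrarily large. -/
def marker (s : ℕ) (b : Bool) (j : ℕ) : ℕ := Nat.pair s (Nat.pair b.toNat j)

theorem le_marker (s : ℕ) (b : Bool) (j : ℕ) : j ≤ marker s b j :=
  (Nat.right_le_pair _ _).trans (Nat.right_le_pair _ _)

theorem computableIn_of_marker {j : ℕ → ℕ} (hB : ∀ i, B i = true ↔ ∃ s, i = marker s (A s) (j s)) :
    ComputableIn (oracle B) A := by
  have hdec : Computable fun q : Bool × ℕ => if q.1 = true then some (decide (q.2 = 1)) else none :=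
    (Primrec.ite (Primrec.eq.comp Primrec.fst (Primrec.const true)) (Primrec.option_some.comp
      (Primrec.eq.comp Primrec.snd (Primrec.const 1)).decide) (Primrec.const none)).to_comp
  have hquery : ComputableIn (oracle B) fun p : ℕ × ℕ => B (Nat.pair p.1 p.2) :=
    computableIn_comp (computableIn_oracle B) Primrec₂.natPair.to_comp.computableIn
  have hbit : ComputableIn (oracle B) fun p : ℕ × ℕ => p.2.unpair.1 :=
    (Primrec.fst.comp (Primrec.unpair.comp Primrec.snd)).to_comp.computableIn
  refine computableIn_of_search (computableIn_comp hdec.computableIn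
    (computableIn_prodMk hquery hbit)) (fun s => ⟨Nat.pair (A s).toNat (j s), ?_⟩)
    fun s k v hv => ?_
  · have hj : B (Nat.pair s (Nat.pair (A s).toNat (j s))) = true := (hB _).2 ⟨s, rfl⟩
    cases h : A s <;> simp_all
  · obtain ⟨hk, rfl⟩ : B (Nat.pair s k) = true ∧ decide (k.unpair.1 = 1) = v := by simpa using hv
    obtain ⟨t, ht⟩ := (hB _).1 hk
    obtain ⟨rfl, rfl⟩ := Nat.pair_eq_pair.1 ht
    cases A s <;> simp

/-- A condition of the finite extension argument that builds `A` and `B`: `A` extends `str` and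
`B` agrees with `seq` below `len`, while the test levels `A` has to avoid, united in
`avoid B`, leave a set of positive measure of possible `A`. -/
structure Condition where
  str : List Bool
  seq : Cantor
  len : ℕ
  avoid : Cantor → Set Cantor
  semicontinuous : AlmostUpperSemicontinuous avoid
  pos : ∀ Y ∈ PiNat.cylinder seq len, 0 < fairCoin.real (basicOpen (some str) \ avoid Y)

/-- The condition `q` extends `p` by the bit `b` of `A`, announced by an element of `B`, and
makes `A` avoid some level of `Φ` if that is a uniform test. -/
structure Condition.Step (Φ : Cantor → TestCode) (p q : Condition) (b : Bool) (j : ℕ) : Prop where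
  str_eq : q.str = p.str ++ [b]
  len_le : p.len ≤ marker p.str.length b j
  len_eq : q.len = marker p.str.length b j + 1
  seq_eq : q.seq = Function.update p.seq (marker p.str.length b j) true
  avoid_subset : ∀ Y, p.avoid Y ⊆ q.avoid Y
  level_subset : IsUniformSchnorrTest Φ → ∃ n, ∀ Y, (Φ Y).level n ⊆ q.avoid Y

theorem exists_append_pos {P : Set Cantor} {σ : List Bool}
    (h : 0 < fairCoin.real (basicOpen (some σ) \ P)) :
    ∃ b, 0 < fairCoin.real (basicOpen (some (σ ++ [b])) \ P) := by
  by_contra! hle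
  rw [basicOpen_eq_union, Set.union_sdiff_distrib] at h
  linarith [measureReal_union_le (μ := fairCoin) (basicOpen (some (σ ++ [false])) \ P)
    (basicOpen (some (σ ++ [true])) \ P), hle false, hle true]

theorem Condition.exists_avoid (p : Condition) (Φ : Cantor → TestCode) :
    ∃ W : Cantor → Set Cantor, AlmostUpperSemicontinuous W ∧
      0 < fairCoin.real (basicOpen (some p.str) \ W p.seq) ∧ (∀ Y, p.avoid Y ⊆ W Y) ∧
      (IsUniformSchnorrTest Φ → ∃ n, ∀ Y, (Φ Y).level n ⊆ W Y) := by
  have hpos := p.pos p.seq (PiNat.self_mem_cylinder _ _)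
  by_cases hΦ : IsUniformSchnorrTest Φ
  swap
  · exact ⟨p.avoid, p.semicontinuous, hpos, fun _ => subset_rfl, fun h => absurd h hΦ⟩
  obtain ⟨n, hn⟩ := exists_pow_lt_of_lt_one hpos (one_half_lt_one (α := ℝ))
  refine ⟨fun Y => p.avoid Y ∪ (Φ Y).level n, p.semicontinuous.union
    (hΦ.almostUpperSemicontinuous n), ?_, fun _ => Set.subset_union_left,
    fun _ => ⟨n, fun _ => Set.subset_union_right⟩⟩
  rw [← Set.sdiff_sdiff]
  linarith [le_measureReal_sdiff (μ := fairCoin) (s₁ := basicOpen (some p.str) \ p.avoid p.seq)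
    (s₂ := (Φ p.seq).level n), (hΦ.2 p.seq).real_level_le n]

theorem Condition.exists_step (p : Condition) (Φ : Cantor → TestCode) :
    ∃ q b j, Condition.Step Φ p q b j := by
  obtain ⟨W, hW, hpos, hsub, hlevel⟩ := p.exists_avoid Φ
  obtain ⟨b, hb⟩ := exists_append_pos hpos
  obtain ⟨k, hk⟩ := (hasAntitoneBasis_cylinder p.seq).mem_iff.1 (hW.eventually_pos hb)
  let i := marker p.str.length b (max p.len k)
  have hi : max p.len k ≤ i := le_marker _ _ _
  refine ⟨⟨p.str ++ [b], Function.update p.seq i true, i + 1, W, hW, fun Y hY => hk ?_⟩, b,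
    max p.len k, rfl, (le_max_left _ _).trans hi, rfl, rfl, hsub, hlevel⟩
  intro m hm
  have hmi : m < i := hm.trans_le ((le_max_right _ _).trans hi)
  rw [hY m (hmi.trans i.lt_succ_self), Function.update_of_ne hmi.ne]

/-- The condition that imposes no restriction. -/
def Condition.initial : Condition where
  str := []
  seq := fun _ => false
  len := 0
  avoid := fun _ => ∅
  semicontinuous := fun X => by simp
  pos := fun Y _ => by simp [basicOpen, initSeg]

theorem exists_run (Φ : ℕ → Cantor → TestCode) :
    ∃ (p : ℕ → Condition) (A : Cantor) (j : ℕ → ℕ), p 0 = Condition.initial ∧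
      ∀ s, Condition.Step (Φ s) (p s) (p (s + 1)) (A s) (j s) := by
  choose next bit pad hstep using Condition.exists_step
  let p : ℕ → Condition := fun s => s.rec Condition.initial fun s p => next p (Φ s)
  exact ⟨p, fun s => bit (p s) (Φ s), fun s => pad (p s) (Φ s), rfl, fun s => hstep _ _⟩

section Run

variable {Φ : ℕ → Cantor → TestCode} {p : ℕ → Condition} {j : ℕ → ℕ}
  (h0 : p 0 = Condition.initial)
  (hstep : ∀ s, Condition.Step (Φ s) (p s) (p (s + 1)) (A s) (j s))

include h0 hstep

theorem str_run (s : ℕ) : (p s).str = initSeg A s := by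
  induction s with
  | zero => rw [h0]; rfl
  | succ s ih => rw [(hstep s).str_eq, ih, initSeg_succ]

theorem seq_run (s i : ℕ) : (p s).seq i = true ↔ ∃ t < s, i = marker t (A t) (j t) := by
  induction s with
  | zero => simp [h0, Condition.initial]
  | succ s ih =>
    rw [(hstep s).seq_eq, str_run h0 hstep, length_initSeg, Function.update_apply]
    simp only [Nat.lt_succ_iff_lt_or_eq, or_and_right, exists_or, exists_eq_left, ← ih]
    split_ifs with h <;> simp [h]

theorem mem_cylinder_run (hB : ∀ i, B i = true ↔ ∃ s, i = marker s (A s) (j s)) (s : ℕ) :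
    B ∈ PiNat.cylinder (p s).seq (p s).len := by
  have hle : ∀ t, (p t).len ≤ marker t (A t) (j t) := fun t => by
    simpa [str_run h0 hstep] using (hstep t).len_le
  have hmono : Monotone fun t => (p t).len := monotone_nat_of_le_succ fun t => by
    rw [(hstep t).len_eq]
    exact (hstep t).len_le.trans (Nat.le_succ _)
  intro i hi
  rw [Bool.eq_iff_iff, hB, seq_run h0 hstep]
  refine ⟨fun ⟨t, ht⟩ => ⟨t, ?_, ht⟩, fun ⟨t, _, ht⟩ => ⟨t, ht⟩⟩
  by_contra! hst
  exact (ht ▸ hi).not_ge ((hmono hst).trans (hle t))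

theorem exists_notMem_level_run (hB : ∀ i, B i = true ↔ ∃ s, i = marker s (A s) (j s)) {e : ℕ}
    (he : IsUniformSchnorrTest (Φ e)) : ∃ n, A ∉ (Φ e B).level n := by
  obtain ⟨n, hn⟩ := (hstep e).level_subset he
  refine ⟨n, fun hA => ?_⟩
  obtain ⟨k, hk⟩ := (hasAntitoneBasis_cylinder A).mem_iff.1 ((isOpen_level (Φ e B) n).mem_nhds hA)
  have hmono : Monotone fun s => (p s).avoid B :=
    monotone_nat_of_le_succ fun s => (hstep s).avoid_subset B
  let s := max k (e + 1)
  have hcovered : basicOpen (some (p s).str) ⊆ (p s).avoid B := by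
    rw [str_run h0 hstep, basicOpen_initSeg]
    exact ((PiNat.cylinder_anti A (le_max_left _ _)).trans hk).trans
      ((hn B).trans (hmono (le_max_right _ _)))
  have hpos := (p s).pos B (mem_cylinder_run h0 hstep hB s)
  rw [Set.sdiff_eq_empty.2 hcovered, measureReal_empty] at hpos
  exact hpos.false

end Run

theorem exists_uniformly_schnorrRandom_computableIn :
    ∃ A B : Cantor, SchnorrRandomUniformlyRelativeTo A B ∧ ComputableIn (oracle B) A := by
  classical
  have hcountable : {Φ : Cantor → TestCode | TotalComputableFunctional Φ}.Countable :=
    countable_setOf_totalComputableFunctional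
  obtain ⟨Φ, hΦ⟩ := Set.countable_iff_exists_subset_range.1 hcountable
  obtain ⟨p, A, j, h0, hstep⟩ := exists_run Φ
  let B : Cantor := fun i => decide (∃ s, i = marker s (A s) (j s))
  have hB : ∀ i, B i = true ↔ ∃ s, i = marker s (A s) (j s) := fun i => decide_eq_true_iff
  refine ⟨A, B, fun ⟨Ψ, hΨ, hA⟩ => ?_, computableIn_of_marker hB⟩
  obtain ⟨e, rfl⟩ : Ψ ∈ Set.range Φ := hΦ hΨ.1
  obtain ⟨n, hn⟩ := exists_notMem_level_run h0 hstep hB hΨ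
  exact hn (hA n)

end Separation

end SchnorrRel

theorem proposition6p6 :
    (∀ A B : SchnorrRel.Cantor,
      SchnorrRel.TTTestSchnorrRandomRelativeTo A B ↔ SchnorrRel.SchnorrRandomRelativeTo A B) ∧
    (∃ A B : SchnorrRel.Cantor,
      SchnorrRel.SchnorrRandomUniformlyRelativeTo A B ∧
        ¬ SchnorrRel.TTTestSchnorrRandomRelativeTo A B) := by
  refine ⟨fun A B => SchnorrRel.ttTestSchnorrRandomRelativeTo_iff, ?_⟩
  obtain ⟨A, B, huniform, hA⟩ := SchnorrRel.exists_uniformly_schnorrRandom_computableIn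
  exact ⟨A, B, huniform, fun h => SchnorrRel.not_schnorrRandomRelativeTo_of_computableIn hA
    (SchnorrRel.ttTestSchnorrRandomRelativeTo_iff.1 h)⟩
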